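/- Let $d$ be a dimension and let $(\{X\},\{Y\},T)$ be a random triple, defined on a probability space $(\Omega,\mathcal F,\mathbb P)$, of two locally finite point sets $\{X\},\{Y\}\subset\mathbb R^d$ and a bijection $T$ of $\{X\}$ onto $\{Y\}$, such that the number $N_{U,V}:=\#\{(X,Y)\in U\times V : Y=T(X)\}$ is measurable for all Borel sets $U,V\subset\mathbb R^d$. Assume that (i) $\{X\}$ and $\{Y\}$ are independent Poisson point processes of unit intensity; (ii) the law of $(\{X\},\{Y\},T)$, on the $\sigma$-algebra generated by the observables $N_{U,V}$, is invariant (stationary) and ergodic under the action of $\mathbb Z^d\ni\bar x$ given by $(\{X\},\{Y\},T)\mapsto(\{\bar x+X\},\{\bar x+Y\},T(\cdot-\bar x)+\bar x)$; (iii) almost surely, $T$ is cyclically monotone, i.e. for every finite subset $\{X_n\}_{n=1}^N$ of $\{X\}$ (enumerated in any way) one has $\sum_{n=1}^N T(X_n)\cdot(X_n-X_{n-1})\ge 0$, where $X_0:=X_N$. Then for every $\varepsilon>0$ there exists a random radius (a measurable map) $r_*:\Omega\to(0,\infty)$ such that almost surely, for every real $R\ge r_*$ and every point $X\in\{X\}\cap(-R,R)^d$,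 $$|T(X)-X|\le\varepsilon R .$$ -/

import Mathlib

open MeasureTheory ProbabilityTheory

noncomputable section

/-- `d`-dimensional Euclidean space. -/
abbrev Space (d : ℕ) : Type := EuclideanSpace ℝ (Fin d)

/-- A locally finite point set `{X} ⊂ ℝ^d`. -/
@[ext]
structure PointConfig (d : ℕ) where
  carrier : Set (Space d)
  locallyFinite : ∀ B : Set (Space d), Bornology.IsBounded B → (carrier ∩ B).Finite

namespace PointConfig

variable {d : ℕ}

/-- The number `#{X ∈ B}` of points in `B`. -/
def count (ξ : PointConfig d) (B : Set (Space d)) : ℕ∞ := (ξ.carrier ∩ B).encard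

/-- The σ-algebra generated by the numbers of points in Borel sets. -/
instance : MeasurableSpace (PointConfig d) :=
  ⨆ (B : Set (Space d)) (_ : MeasurableSet B),
    MeasurableSpace.comap (fun ξ : PointConfig d => ξ.count B) inferInstance

/-- The shifted point set `{v + X}`. -/
def shift (v : Space d) (ξ : PointConfig d) : PointConfig d where
  carrier := {z | z - v ∈ ξ.carrier}
  locallyFinite B hB := by
    have hB' : Bornology.IsBounded ((fun z => z - v) '' B) := by
      obtain ⟨C, hC⟩ := isBounded_iff_forall_norm_le.mp hB
      refine isBounded_iff_forall_norm_le.mpr ⟨C + ‖v‖, ?_⟩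
      rintro _ ⟨z, hz, rfl⟩
      exact (norm_sub_le z v).trans (by linarith [hC z hz])
    refine Set.Finite.of_finite_image (f := fun z => z - v)
      ((ξ.locallyFinite _ hB').subset ?_) (sub_left_injective.injOn)
    rintro _ ⟨z, ⟨hz, hzB⟩, rfl⟩
    exact ⟨hz, z, hzB, rfl⟩

end PointConfig

/-- A random point set `ξ` is a Poisson point process of unit intensity: the number of points in a
Borel set of finite volume is Poisson distributed with the volume as parameter, and the numbers of
points in disjoint sets are independent. -/
structure IsUnitPoissonProcess {d : ℕ} {Ω : Type*} [MeasurableSpace Ω]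
    (ξ : Ω → PointConfig d) (P : Measure Ω) : Prop where
  hasLaw_count : ∀ B : Set (Space d), MeasurableSet B → volume B ≠ ⊤ →
    HasLaw (fun ω => (ξ ω).count B)
      ((poissonMeasure (volume B).toNNReal).map (Nat.cast : ℕ → ℕ∞)) P
  iIndepFun_count : ∀ (n : ℕ) (B : Fin n → Set (Space d)),
    (∀ i, MeasurableSet (B i)) → (∀ i, volume (B i) ≠ ⊤) →
    Pairwise (fun i j => Disjoint (B i) (B j)) →
    iIndepFun (fun i ω => (ξ ω).count (B i)) P

/-- A triple `({X}, {Y}, T)` of two locally finite point sets and a bijection `T` of `{X}` onto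
`{Y}`. -/
structure Matching (d : ℕ) where
  X : PointConfig d
  Y : PointConfig d
  T : X.carrier ≃ Y.carrier

namespace Matching

variable {d : ℕ}

/-- The number `N_{U,V}` of matched pairs `(X, Y) ∈ U × V`. -/
def count (m : Matching d) (U V : Set (Space d)) : ℕ∞ :=
  {x : m.X.carrier | (x : Space d) ∈ U ∧ (m.T x : Space d) ∈ V}.encard

/-- The σ-algebra generated by the observables `N_{U,V}`, `U` and `V` Borel. -/
instance : MeasurableSpace (Matching d) :=
  ⨆ (U : Set (Space d)) (V : Set (Space d)) (_ : MeasurableSet U) (_ : MeasurableSet V),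
    MeasurableSpace.comap (fun m : Matching d => m.count U V) inferInstance

/-- The shift `({v + X}, {v + Y}, T(· - v) + v)`. -/
def shift (v : Space d) (m : Matching d) : Matching d where
  X := m.X.shift v
  Y := m.Y.shift v
  T :=
    { toFun := fun z => ⟨(m.T ⟨z.1 - v, z.2⟩ : Space d) + v, by
        simp [PointConfig.shift]⟩
      invFun := fun z => ⟨(m.T.symm ⟨z.1 - v, z.2⟩ : Space d) + v, by
        simp [PointConfig.shift]⟩
      left_inv := fun z => by simp
      right_inv := fun z => by simp }

/-- The point of `ℝ^d` with the given integer coordinates. -/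
def latticePoint (k : Fin d → ℤ) : Space d := WithLp.toLp 2 fun i => (k i : ℝ)

/-- The additive group `ℤ^d` acts on matchings by shifts. -/
instance : VAdd (Fin d → ℤ) (Matching d) := ⟨fun k m => m.shift (latticePoint k)⟩

/-- Cyclical monotonicity: `∑ T(X_n) · (X_n - X_{n-1}) ≥ 0` for every enumerated finite subset
`X_0, …, X_N` of `{X}`; the index `n - 1` in `Fin (N + 1)` is cyclic, so `X_{0-1} = X_N`. -/
def IsCyclicallyMonotone (m : Matching d) : Prop :=
  ∀ (N : ℕ) (x : Fin (N + 1) → m.X.carrier), Function.Injective x →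
    0 ≤ ∑ n, inner ℝ (m.T (x n) : Space d) ((x n : Space d) - (x (n - 1) : Space d))

end Matching

end

/-!
Call a nonempty matching bad at scale `L` if no point within distance `L` of the origin is
matched to such a point. The probability of this event tends to zero as `L → ∞`. By
stationarity, Wiener's maximal inequality for the action of `ℤ^d` therefore provides, almost
surely, one random `L` for which the proportion of bad lattice shifts in every cube around the
origin lies below a given threshold. A subcube whose volume is a larger fraction of the cube
cannot consist of bad shifts only, so at scale `ρ = ε R / 6` every point `z` at distance `O(R)`
from the origin has a matched pair `(Y, T(Y))` with `|Y - z|` and `|T(Y) - Y|` at most `ρ / 2`.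

Given `X` with displacement `D = T(X) - X`, choose such a pair near `z = X + ρ D / |D|`.
Monotonicity, tested on `X` and `Y`, gives `D · (Y - X) ≤ (T(Y) - X) · (Y - X)`. The left side
is at least `|D| ρ / 2` and the right side at most `3 ρ²`, whence `|D| ≤ 6 ρ = ε R`.
-/

section MaximalInequality

open scoped ENNReal

variable {d : ℕ}

/-- The cube `k + {-n, …, n}^d` of `ℤ^d`, which is the closed ball of radius `n` around `k` for the
supremum distance. -/
noncomputable def latticeCube (k : Fin d → ℤ) (n : ℕ) : Finset (Fin d → ℤ) :=
  Finset.Icc (k - n) (k + n)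

theorem mem_latticeCube {k j : Fin d → ℤ} {n : ℕ} :
    j ∈ latticeCube k n ↔ ∀ i, |j i - k i| ≤ n := by
  simp only [latticeCube, Finset.mem_Icc, Pi.le_def, abs_le, ← forall_and]
  refine forall_congr' fun i => ?_
  simp only [Pi.sub_apply, Pi.add_apply, Pi.natCast_apply]
  constructor <;> rintro ⟨_, _⟩ <;> constructor <;> linarith

theorem mem_latticeCube_iff_dist {k j : Fin d → ℤ} {n : ℕ} :
    j ∈ latticeCube k n ↔ dist j k ≤ n := by
  rw [mem_latticeCube, dist_pi_le_iff (Nat.cast_nonneg n)]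
  refine forall_congr' fun i => ?_
  rw [Int.dist_eq]
  exact_mod_cast Iff.rfl

theorem card_latticeCube (k : Fin d → ℤ) (n : ℕ) : (latticeCube k n).card = (2 * n + 1) ^ d := by
  have card_side (i : Fin d) : (Finset.Icc (k i - n) (k i + n)).card = 2 * n + 1 := by
    rw [Int.card_Icc]
    lia
  simp only [latticeCube, Pi.card_Icc, Pi.sub_apply, Pi.add_apply, Pi.natCast_apply, card_side,
    Finset.prod_const, Finset.card_univ, Fintype.card_fin]

theorem latticeCube_subset_latticeCube {k l : Fin d → ℤ} {m n : ℕ} (h : dist k l + m ≤ n) :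
    latticeCube k m ⊆ latticeCube l n := fun j hj => by
  rw [mem_latticeCube_iff_dist] at hj ⊢
  linarith [dist_triangle j k l]

theorem neg_mem_latticeCube_neg {k j : Fin d → ℤ} {n : ℕ} :
    -j ∈ latticeCube (-k) n ↔ j ∈ latticeCube k n := by
  simp only [mem_latticeCube_iff_dist, dist_neg_neg]

theorem sum_latticeCube_eq_sum_add {β : Type*} [AddCommMonoid β] (g : (Fin d → ℤ) → β)
    (k : Fin d → ℤ) (n : ℕ) :
    ∑ j ∈ latticeCube k n, g j = ∑ j ∈ latticeCube 0 n, g (j + k) := by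
  refine (Finset.sum_bij (fun j _ => j + k) (fun j hj => ?_) (fun _ _ _ _ => add_right_cancel)
    (fun j hj => ⟨j - k, ?_, sub_add_cancel j k⟩) fun _ _ => rfl).symm
  · simpa only [mem_latticeCube, Pi.add_apply, add_sub_cancel_right, Pi.zero_apply, sub_zero]
      using hj
  · simpa only [mem_latticeCube, Pi.sub_apply, Pi.zero_apply, sub_zero] using hj

theorem exists_pairwiseDisjoint_latticeCube_cover (S : Finset (Fin d → ℤ))
    (n : (Fin d → ℤ) → ℕ) :
    ∃ u ⊆ S, (u : Set (Fin d → ℤ)).PairwiseDisjoint (fun k => latticeCube k (n k)) ∧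
      S ⊆ u.biUnion fun k => latticeCube k (4 * n k) := by
  obtain ⟨u, huS, hdisj, hcover⟩ :=
    Vitali.exists_disjoint_subfamily_covering_enlargement_closedBall (S : Set (Fin d → ℤ)) id
      (fun k => (n k : ℝ)) (S.sup n : ℕ) (fun k hk => Nat.cast_le.2 (Finset.le_sup hk))
      4 (by norm_num)
  lift u to Finset (Fin d → ℤ) using S.finite_toSet.subset huS
  refine ⟨u, Finset.coe_subset.1 huS, fun a ha b hb hab => ?_, fun k hk => ?_⟩
  · exact Finset.disjoint_left.2 fun j hja hjb => Set.disjoint_left.1 (hdisj ha hb hab)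
      (mem_latticeCube_iff_dist.1 hja) (mem_latticeCube_iff_dist.1 hjb)
  · obtain ⟨b, hb, hsub⟩ := hcover k hk
    refine Finset.mem_biUnion.2 ⟨b, hb, mem_latticeCube_iff_dist.2 ?_⟩
    simpa only [id_eq, Metric.mem_closedBall, Nat.cast_mul, Nat.cast_ofNat] using
      hsub (Metric.mem_closedBall_self (Nat.cast_nonneg _))

/-- The weak-type Hardy–Littlewood maximal inequality on `ℤ^d`. -/
theorem mul_card_le_sum_of_forall_le_sum_latticeCube (g : (Fin d → ℤ) → ℝ≥0∞) (lam : ℝ≥0∞)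
    {S A : Finset (Fin d → ℤ)} (n : (Fin d → ℤ) → ℕ)
    (hS : ∀ k ∈ S, lam * (2 * n k + 1) ^ d ≤ ∑ j ∈ latticeCube k (n k), g j)
    (hA : ∀ k ∈ S, latticeCube k (n k) ⊆ A) :
    lam * S.card ≤ 4 ^ d * ∑ j ∈ A, g j := by
  obtain ⟨u, huS, hdisj, hcover⟩ := exists_pairwiseDisjoint_latticeCube_cover S n
  have card_enlarged (k : Fin d → ℤ) :
      ((latticeCube k (4 * n k)).card : ℝ≥0∞) ≤ 4 ^ d * (2 * n k + 1) ^ d := by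
    rw [card_latticeCube, ← mul_pow]
    exact_mod_cast Nat.pow_le_pow_left (by lia) d
  have card_le : (S.card : ℝ≥0∞) ≤ ∑ k ∈ u, 4 ^ d * (2 * n k + 1 : ℝ≥0∞) ^ d := calc
    (S.card : ℝ≥0∞) ≤ ∑ k ∈ u, ((latticeCube k (4 * n k)).card : ℝ≥0∞) := by
      exact_mod_cast (Finset.card_le_card hcover).trans Finset.card_biUnion_le
    _ ≤ _ := Finset.sum_le_sum fun k _ => card_enlarged k
  calc lam * S.card ≤ lam * ∑ k ∈ u, 4 ^ d * (2 * n k + 1 : ℝ≥0∞) ^ d := by gcongr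
    _ = 4 ^ d * ∑ k ∈ u, lam * (2 * n k + 1 : ℝ≥0∞) ^ d := by
      simp only [Finset.mul_sum, mul_left_comm]
    _ ≤ 4 ^ d * ∑ k ∈ u, ∑ j ∈ latticeCube k (n k), g j := by
      gcongr with k hk
      exact hS k (huS hk)
    _ = 4 ^ d * ∑ j ∈ u.biUnion fun k => latticeCube k (n k), g j := by
      rw [Finset.sum_biUnion hdisj]
    _ ≤ 4 ^ d * ∑ j ∈ A, g j := by
      gcongr
      exact Finset.biUnion_subset.2 fun k hk => hA k (huS hk)

variable {α : Type*}

/-- The average of `f` over the orbit segment `{j +ᵥ x | j ∈ {-n, …, n}^d}` of `x`. -/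
noncomputable def cubeAverage (d : ℕ) [VAdd (Fin d → ℤ) α] (f : α → ℝ≥0∞) (n : ℕ)
    (x : α) : ℝ≥0∞ :=
  (∑ j ∈ latticeCube (0 : Fin d → ℤ) n, f (j +ᵥ x)) / (2 * n + 1) ^ d

theorem le_cubeAverage_iff [VAdd (Fin d → ℤ) α] {f : α → ℝ≥0∞} {lam : ℝ≥0∞} {n : ℕ} {x : α} :
    lam ≤ cubeAverage d f n x ↔
      lam * (2 * n + 1) ^ d ≤ ∑ j ∈ latticeCube (0 : Fin d → ℤ) n, f (j +ᵥ x) :=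
  ENNReal.le_div_iff_mul_le (.inl (by positivity)) (.inl (by finiteness))

theorem measurable_cubeAverage [VAdd (Fin d → ℤ) α] [MeasurableSpace α]
    [MeasurableConstVAdd (Fin d → ℤ) α] {f : α → ℝ≥0∞} (hf : Measurable f) (n : ℕ) :
    Measurable (cubeAverage d f n) :=
  (Finset.measurable_fun_sum _ fun j _ => hf.comp (measurable_const_vadd j)).div_const _

variable [AddAction (Fin d → ℤ) α]

open Classical in
theorem mul_card_filter_le_cubeAverage (f : α → ℝ≥0∞) (lam : ℝ≥0∞) (K N : ℕ) (x : α) :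
    lam * ((latticeCube (0 : Fin d → ℤ) K).filter
        fun k => ∃ n ≤ N, lam ≤ cubeAverage d f n (k +ᵥ x)).card ≤
      4 ^ d * ∑ j ∈ latticeCube (0 : Fin d → ℤ) (K + N), f (j +ᵥ x) := by
  have exists_radius (k : Fin d → ℤ) : ∃ n : ℕ,
      (∃ n ≤ N, lam ≤ cubeAverage d f n (k +ᵥ x)) →
        n ≤ N ∧ lam ≤ cubeAverage d f n (k +ᵥ x) := by
    by_cases h : ∃ n ≤ N, lam ≤ cubeAverage d f n (k +ᵥ x)
    · exact h.imp fun _ hn _ => hn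
    · exact ⟨0, fun h' => absurd h' h⟩
  choose n hn using exists_radius
  refine mul_card_le_sum_of_forall_le_sum_latticeCube _ lam n (fun k hk => ?_) fun k hk => ?_
  · rw [sum_latticeCube_eq_sum_add]
    simpa only [le_cubeAverage_iff, vadd_vadd] using (hn k (Finset.mem_filter.1 hk).2).2
  · obtain ⟨hkK, hkN⟩ := Finset.mem_filter.1 hk
    refine latticeCube_subset_latticeCube ?_
    rw [Nat.cast_add]
    exact add_le_add (mem_latticeCube_iff_dist.1 hkK) (Nat.cast_le.2 (hn k hkN).1)

variable [MeasurableSpace α] [MeasurableConstVAdd (Fin d → ℤ) α]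
  (μ : Measure α) [VAddInvariantMeasure (Fin d → ℤ) α μ]

theorem lintegral_sum_latticeCube_vadd {f : α → ℝ≥0∞} (hf : Measurable f) (n : ℕ) :
    ∫⁻ x, ∑ j ∈ latticeCube (0 : Fin d → ℤ) n, f (j +ᵥ x) ∂μ =
      (2 * n + 1) ^ d * ∫⁻ x, f x ∂μ := by
  rw [lintegral_finsetSum (latticeCube (0 : Fin d → ℤ) n) (f := fun j x => f (j +ᵥ x))
    fun j _ => hf.comp (measurable_const_vadd j)]
  simp only [(measurePreserving_vadd _ μ).lintegral_comp hf, Finset.sum_const, card_latticeCube,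
    nsmul_eq_mul]
  push_cast
  rfl

theorem mul_measure_exists_bounded_le_cubeAverage_le {f : α → ℝ≥0∞} (hf : Measurable f)
    (lam : ℝ≥0∞) (N : ℕ) :
    lam * μ {x | ∃ n ≤ N, lam ≤ cubeAverage d f n x} ≤ 8 ^ d * ∫⁻ x, f x ∂μ := by
  classical
  set A := {x | ∃ n ≤ N, lam ≤ cubeAverage d f n x} with hA
  have hAm : MeasurableSet A := by
    simp only [hA, ← exists_prop, Set.ofPred_exists]
    exact .iUnion fun n => .iUnion fun _ =>
      measurableSet_le measurable_const (measurable_cubeAverage hf n)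
  have hAind : Measurable (A.indicator (1 : α → ℝ≥0∞)) := measurable_one.indicator hAm
  have count_le (x : α) : lam * ∑ k ∈ latticeCube (0 : Fin d → ℤ) N, A.indicator 1 (k +ᵥ x) ≤
      4 ^ d * ∑ j ∈ latticeCube (0 : Fin d → ℤ) (N + N), f (j +ᵥ x) := by
    simpa only [Set.indicator_apply, Pi.one_apply, Finset.sum_boole, hA, Set.mem_ofPred_eq]
      using mul_card_filter_le_cubeAverage f lam N N x
  have measurable_sum {g : α → ℝ≥0∞} (hg : Measurable g) (n : ℕ) :
      Measurable fun x => ∑ j ∈ latticeCube (0 : Fin d → ℤ) n, g (j +ᵥ x) :=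
    Finset.measurable_fun_sum _ fun j _ => hg.comp (measurable_const_vadd j)
  have volume_doubling : (2 * (N + N : ℕ) + 1 : ℝ≥0∞) ^ d ≤ 2 ^ d * (2 * N + 1) ^ d := by
    rw [← mul_pow]
    exact_mod_cast Nat.pow_le_pow_left (by lia) d
  refine (ENNReal.mul_le_mul_iff_right (a := (2 * N + 1) ^ d) (by positivity) (by finiteness)).1 ?_
  calc (2 * N + 1 : ℝ≥0∞) ^ d * (lam * μ A)
      = ∫⁻ x, lam * ∑ k ∈ latticeCube (0 : Fin d → ℤ) N, A.indicator 1 (k +ᵥ x) ∂μ := by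
        rw [lintegral_const_mul _ (measurable_sum hAind N), lintegral_sum_latticeCube_vadd μ hAind,
          lintegral_indicator_one hAm, mul_left_comm]
    _ ≤ ∫⁻ x, 4 ^ d * ∑ j ∈ latticeCube (0 : Fin d → ℤ) (N + N), f (j +ᵥ x) ∂μ :=
        lintegral_mono count_le
    _ = 4 ^ d * ((2 * (N + N : ℕ) + 1) ^ d * ∫⁻ x, f x ∂μ) := by
        rw [lintegral_const_mul _ (measurable_sum hf _), lintegral_sum_latticeCube_vadd μ hf]
    _ ≤ 4 ^ d * (2 ^ d * (2 * N + 1) ^ d * ∫⁻ x, f x ∂μ) := by gcongr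
    _ = (2 * N + 1) ^ d * (8 ^ d * ∫⁻ x, f x ∂μ) := by
        rw [show (8 : ℝ≥0∞) = 4 * 2 by norm_num, mul_pow]
        ring

/-- Wiener's maximal ergodic inequality. -/
theorem mul_measure_exists_le_cubeAverage_le {f : α → ℝ≥0∞} (hf : Measurable f) (lam : ℝ≥0∞) :
    lam * μ {x | ∃ n, lam ≤ cubeAverage d f n x} ≤ 8 ^ d * ∫⁻ x, f x ∂μ := by
  have eq_iUnion : {x | ∃ n, lam ≤ cubeAverage d f n x} =
      ⋃ N, {x | ∃ n ≤ N, lam ≤ cubeAverage d f n x} := by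
    ext x
    simp only [Set.mem_ofPred_eq, Set.mem_iUnion]
    exact ⟨fun ⟨n, hn⟩ => ⟨n, n, le_rfl, hn⟩, fun ⟨_, n, _, hn⟩ => ⟨n, hn⟩⟩
  have hmono : Monotone fun N => {x | ∃ n ≤ N, lam ≤ cubeAverage d f n x} :=
    fun N N' h x ⟨n, hn, hx⟩ => ⟨n, hn.trans h, hx⟩
  rw [eq_iUnion, hmono.measure_iUnion, ENNReal.mul_iSup]
  exact iSup_le fun N => mul_measure_exists_bounded_le_cubeAverage_le μ hf lam N

theorem ae_exists_forall_cubeAverage_lt {f : ℕ → α → ℝ≥0∞} (hf : ∀ L, Measurable (f L))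
    (hlim : Filter.Tendsto (fun L => ∫⁻ x, f L x ∂μ) Filter.atTop (nhds 0)) {lam : ℝ≥0∞}
    (hlam : lam ≠ 0) : ∀ᵐ x ∂μ, ∃ L, ∀ n, cubeAverage d (f L) n x < lam := by
  have bound (L : ℕ) : lam * μ {x | ∀ L, ∃ n, lam ≤ cubeAverage d (f L) n x} ≤
      8 ^ d * ∫⁻ x, f L x ∂μ := calc
    _ ≤ lam * μ {x | ∃ n, lam ≤ cubeAverage d (f L) n x} := by
      gcongr
      exact fun hx => hx L
    _ ≤ _ := mul_measure_exists_le_cubeAverage_le μ (hf L) lam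
  have bound_tendsto : Filter.Tendsto (fun L => 8 ^ d * ∫⁻ x, f L x ∂μ) Filter.atTop (nhds 0) := by
    simpa only [mul_zero] using ENNReal.Tendsto.const_mul hlim (.inr (by finiteness))
  have hzero : lam * μ {x | ∀ L, ∃ n, lam ≤ cubeAverage d (f L) n x} = 0 :=
    le_zero_iff.1 (ge_of_tendsto' bound_tendsto bound)
  filter_upwards [measure_eq_zero_iff_ae_notMem.1 ((mul_eq_zero.1 hzero).resolve_left hlam)]
    with x hx
  simpa only [Set.mem_ofPred_eq, not_forall, not_exists, not_le] using hx

end MaximalInequality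

theorem exists_measurable_nat_ae_mem {α : Type*} [MeasurableSpace α] {μ : Measure α}
    {s : ℕ → Set α} (hs : ∀ n, MeasurableSet (s n)) (h : ∀ᵐ x ∂μ, ∃ n, x ∈ s n) :
    ∃ N : α → ℕ, Measurable N ∧ ∀ᵐ x ∂μ, x ∈ s (N x) := by
  classical
  let p (x : α) (n : ℕ) : Prop := x ∈ s n ∨ x ∉ ⋃ n, s n
  have exists_p (x : α) : ∃ n, p x n := by
    by_cases hx : x ∈ ⋃ n, s n
    · exact (Set.mem_iUnion.1 hx).imp fun _ => Or.inl
    · exact ⟨0, Or.inr hx⟩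
  refine ⟨fun x => Nat.find (exists_p x),
    measurable_find exists_p fun n => (hs n).union (MeasurableSet.iUnion hs).compl, ?_⟩
  filter_upwards [h] with x hx
  exact (Nat.find_spec (exists_p x)).resolve_right (not_not_intro (Set.mem_iUnion.2 hx))

theorem norm_sub_le_of_inner_sub_nonneg {E : Type*} [NormedAddCommGroup E] [InnerProductSpace ℝ E]
    {x x' y y' : E} {ρ : ℝ} (hρ : 0 < ρ) (hmono : 0 ≤ inner ℝ (x' - y') (x - y))
    (hy : ‖y - (x + (ρ / ‖x' - x‖) • (x' - x))‖ ≤ ρ / 2) (hy' : ‖y' - y‖ ≤ ρ / 2) :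
    ‖x' - x‖ ≤ 6 * ρ := by
  rcases eq_or_ne (x' - x) 0 with hD | hD
  · rw [hD, norm_zero]
    positivity
  set D := x' - x
  set w := y - (x + (ρ / ‖D‖) • D) with hw
  have hDpos : 0 < ‖D‖ := norm_pos_iff.2 hD
  have hstep : ‖(ρ / ‖D‖) • D‖ = ρ := by
    rw [norm_smul, Real.norm_of_nonneg (by positivity), div_mul_cancel₀ _ hDpos.ne']
  have hyx : y - x = (ρ / ‖D‖) • D + w := by
    rw [hw]
    abel
  have hyx_norm : ‖y - x‖ ≤ 3 / 2 * ρ := by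
    rw [hyx]
    linarith [norm_add_le ((ρ / ‖D‖) • D) w]
  have lower : ‖D‖ * (ρ / 2) ≤ inner ℝ D (y - x) := by
    have hDw : -(‖D‖ * (ρ / 2)) ≤ inner ℝ D w := (neg_le_neg (by gcongr)).trans
      (neg_le_of_abs_le (abs_real_inner_le_norm D w))
    have hDD : inner ℝ D ((ρ / ‖D‖) • D) = ‖D‖ * ρ := by
      rw [inner_smul_right, real_inner_self_eq_norm_sq]
      field_simp
    rw [hyx, inner_add_right, hDD]
    linarith
  have upper : inner ℝ D (y - x) ≤ 2 * ρ * (3 / 2 * ρ) := calc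
    inner ℝ D (y - x) ≤ inner ℝ (y' - y + (y - x)) (y - x) := by
      rw [← sub_nonneg, ← inner_sub_left, ← neg_sub x y, inner_neg_right, ← inner_neg_left]
      convert hmono using 2
      simp only [D]
      abel
    _ ≤ ‖y' - y + (y - x)‖ * ‖y - x‖ := real_inner_le_norm _ _
    _ ≤ 2 * ρ * (3 / 2 * ρ) := by
      gcongr
      linarith [norm_add_le (y' - y) (y - x)]
  refine le_of_mul_le_mul_right ?_ (half_pos hρ)
  linarith

theorem norm_le_mul_of_forall_abs_le {d : ℕ} {a : ℝ} (ha : 0 ≤ a) {y : Space d}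
    (hy : ∀ i, |y i| ≤ a) : ‖y‖ ≤ d * a := by
  refine le_of_sq_le_sq ?_ (by positivity)
  calc ‖y‖ ^ 2 = ∑ i, ‖y i‖ ^ 2 := EuclideanSpace.norm_sq_eq y
    _ ≤ ∑ _i : Fin d, a ^ 2 := by
      gcongr with i
      exact hy i
    _ = d * a ^ 2 := by
      rw [Finset.sum_const, Finset.card_univ, Fintype.card_fin, nsmul_eq_mul]
    _ ≤ (d * a) ^ 2 := by
      rw [mul_pow]
      gcongr
      exact_mod_cast Nat.le_self_pow two_ne_zero d

namespace Matching

variable {d : ℕ}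

section Shift

theorem latticePoint_zero : latticePoint (0 : Fin d → ℤ) = 0 := by
  ext i
  simp [latticePoint]

theorem latticePoint_add (k j : Fin d → ℤ) :
    latticePoint (k + j) = latticePoint k + latticePoint j := by
  ext i
  simp [latticePoint]

theorem latticePoint_neg (k : Fin d → ℤ) : latticePoint (-k) = -latticePoint k := by
  ext i
  simp [latticePoint]

theorem ext_of_X_of_T {m m' : Matching d} (hX : m.X = m'.X)
    (hT : ∀ z hz hz', (m.T ⟨z, hz⟩ : Space d) = m'.T ⟨z, hz'⟩) : m = m' := by
  obtain ⟨X, Y, T⟩ := m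
  obtain ⟨X', Y', T'⟩ := m'
  obtain rfl : X = X' := hX
  have hTT (x : X.carrier) : (T x : Space d) = T' x := hT x x.2 x.2
  obtain rfl : Y = Y' := PointConfig.ext <| by
    rw [← Subtype.range_coe (s := Y.carrier), ← Subtype.range_coe (s := Y'.carrier),
      ← T.surjective.range_comp, ← T'.surjective.range_comp]
    exact congrArg Set.range (funext hTT)
  obtain rfl : T = T' := Equiv.ext fun x => Subtype.ext (hTT x)
  rfl

theorem coe_shift_T_apply (v : Space d) (m : Matching d) (z : (m.shift v).X.carrier) :
    ((m.shift v).T z : Space d) = m.T ⟨z - v, z.2⟩ + v := rfl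

theorem shift_zero (m : Matching d) : m.shift 0 = m := by
  refine ext_of_X_of_T (PointConfig.ext ?_) fun z hz hz' => ?_
  · simp [shift, PointConfig.shift]
  · simp [coe_shift_T_apply]

theorem shift_shift (v w : Space d) (m : Matching d) : (m.shift w).shift v = m.shift (v + w) := by
  refine ext_of_X_of_T (PointConfig.ext ?_) fun z hz hz' => ?_
  · simp [shift, PointConfig.shift, sub_sub]
  · simp [coe_shift_T_apply, sub_sub, add_assoc, add_comm]

instance : AddAction (Fin d → ℤ) (Matching d) where
  zero_vadd m := (congrArg m.shift latticePoint_zero).trans m.shift_zero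
  add_vadd k j m := (congrArg m.shift (latticePoint_add k j)).trans
    (shift_shift (latticePoint k) (latticePoint j) m).symm

theorem count_shift (v : Space d) (m : Matching d) (U V : Set (Space d)) :
    (m.shift v).count U V = m.count ((· + v) ⁻¹' U) ((· + v) ⁻¹' V) := by
  let f (z : (m.shift v).X.carrier) : m.X.carrier := ⟨z - v, z.2⟩
  have hf : Function.Bijective f := by
    refine ⟨fun z w h => Subtype.ext (sub_left_injective (congrArg Subtype.val h)), fun x => ?_⟩
    have hx : (x : Space d) + v ∈ (m.shift v).X.carrier := by simp [shift, PointConfig.shift]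
    exact ⟨⟨x + v, hx⟩, Subtype.ext (add_sub_cancel_right (x : Space d) v)⟩
  rw [count, count, ← Set.encard_preimage_of_bijective hf]
  congr 1
  ext z
  simp [f, coe_shift_T_apply]

theorem count_vadd (k : Fin d → ℤ) (m : Matching d) (U V : Set (Space d)) :
    (k +ᵥ m).count U V =
      m.count ((· + latticePoint k) ⁻¹' U) ((· + latticePoint k) ⁻¹' V) :=
  count_shift (latticePoint k) m U V

end Shift

theorem count_ne_zero {m : Matching d} {U V : Set (Space d)} :
    m.count U V ≠ 0 ↔ ∃ x : m.X.carrier, (x : Space d) ∈ U ∧ (m.T x : Space d) ∈ V :=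
  Set.encard_ne_zero

theorem measurable_count {U V : Set (Space d)} (hU : MeasurableSet U) (hV : MeasurableSet V) :
    Measurable fun m : Matching d => m.count U V :=
  .of_comap_le (le_iSup_of_le U (le_iSup_of_le V (le_iSup_of_le hU (le_iSup_of_le hV le_rfl))))

instance : MeasurableConstVAdd (Fin d → ℤ) (Matching d) where
  measurable_const_vadd k := by
    refine .of_le_map (iSup_le fun U => iSup_le fun V => iSup_le fun hU => iSup_le fun hV => ?_)
    rw [← MeasurableSpace.comap_le_iff_le_map, MeasurableSpace.comap_comp]
    simpa only [Function.comp_def, count_vadd] using (measurable_count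
      (hU.preimage (measurable_add_const _)) (hV.preimage (measurable_add_const _))).comap_le

theorem measurableSet_X_nonempty : MeasurableSet {m : Matching d | m.X.carrier.Nonempty} := by
  have eq_preimage : {m : Matching d | m.X.carrier.Nonempty} =
      (fun m : Matching d => m.count .univ .univ) ⁻¹' {0}ᶜ := by
    ext m
    simp [count_ne_zero, Set.Nonempty]
  rw [eq_preimage]
  exact measurable_count .univ .univ (measurableSet_singleton 0).compl

/-- The event that the point set is nonempty but no point of the ball of radius `L` around the
origin is matched to a point of that ball. -/
def unmatchedNear (L : ℕ) : Set (Matching d) :=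
  {m | m.X.carrier.Nonempty ∧ m.count (Metric.closedBall 0 L) (Metric.closedBall 0 L) = 0}

theorem measurableSet_unmatchedNear (L : ℕ) :
    MeasurableSet (unmatchedNear L : Set (Matching d)) :=
  measurableSet_X_nonempty.inter
    (measurable_count Metric.isClosed_closedBall.measurableSet
      Metric.isClosed_closedBall.measurableSet (measurableSet_singleton 0))

theorem antitone_unmatchedNear : Antitone (unmatchedNear : ℕ → Set (Matching d)) := by
  refine fun L L' hL m ⟨hne, hm⟩ => ⟨hne, ?_⟩
  contrapose! hm
  have hball : Metric.closedBall (0 : Space d) L ⊆ Metric.closedBall 0 L' :=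
    Metric.closedBall_subset_closedBall (Nat.cast_le.2 hL)
  exact count_ne_zero.2 ((count_ne_zero.1 hm).imp fun x hx => ⟨hball hx.1, hball hx.2⟩)

theorem iInter_unmatchedNear : ⋂ L, unmatchedNear L = (∅ : Set (Matching d)) := by
  refine Set.eq_empty_iff_forall_notMem.2 fun m hm => ?_
  rw [Set.mem_iInter] at hm
  obtain ⟨x, hx⟩ := (hm 0).1
  obtain ⟨L, hL⟩ := exists_nat_ge (max ‖x‖ ‖(m.T ⟨x, hx⟩ : Space d)‖)
  exact count_ne_zero.2 ⟨⟨x, hx⟩, mem_closedBall_zero_iff.2 ((le_max_left _ _).trans hL),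
    mem_closedBall_zero_iff.2 ((le_max_right _ _).trans hL)⟩ (hm L).2

theorem tendsto_measure_unmatchedNear (μ : Measure (Matching d)) [IsFiniteMeasure μ] :
    Filter.Tendsto (fun L => μ (unmatchedNear L)) Filter.atTop (nhds 0) := by
  simpa only [iInter_unmatchedNear, measure_empty, Function.comp_def] using
    tendsto_measure_iInter_atTop (μ := μ)
      (fun L => (measurableSet_unmatchedNear L).nullMeasurableSet) antitone_unmatchedNear
      ⟨0, measure_ne_top _ _⟩

theorem exists_norm_sub_latticePoint_le {m : Matching d} (hne : m.X.carrier.Nonempty) {L : ℕ}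
    {k : Fin d → ℤ} (hk : -k +ᵥ m ∉ unmatchedNear L) :
    ∃ y : m.X.carrier, ‖(y : Space d) - latticePoint k‖ ≤ L ∧
      ‖(m.T y : Space d) - latticePoint k‖ ≤ L := by
  have hne' : (-k +ᵥ m).X.carrier.Nonempty := by
    obtain ⟨x, hx⟩ := hne
    refine ⟨x + latticePoint (-k), ?_⟩
    change x + latticePoint (-k) - latticePoint (-k) ∈ m.X.carrier
    rwa [add_sub_cancel_right]
  have hcount : (-k +ᵥ m).count (Metric.closedBall 0 L) (Metric.closedBall 0 L) ≠ 0 :=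
    fun h => hk ⟨hne', h⟩
  rw [count_vadd, count_ne_zero] at hcount
  simpa only [latticePoint_neg, ← sub_eq_add_neg, Set.mem_preimage, mem_closedBall_zero_iff]
    using hcount

theorem exists_measurable_cubeAverage_unmatchedNear_lt (μ : Measure (Matching d))
    [IsFiniteMeasure μ] [VAddInvariantMeasure (Fin d → ℤ) (Matching d) μ] {lam : ENNReal}
    (hlam : lam ≠ 0) :
    ∃ L : Matching d → ℕ, Measurable L ∧
      ∀ᵐ m ∂μ, ∀ n, cubeAverage d ((unmatchedNear (L m)).indicator 1) n m < lam := by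
  have hind (L : ℕ) : Measurable ((unmatchedNear L).indicator (1 : Matching d → ENNReal)) :=
    measurable_one.indicator (measurableSet_unmatchedNear L)
  refine exists_measurable_nat_ae_mem
    (s := fun L => {m | ∀ n, cubeAverage d ((unmatchedNear L).indicator 1) n m < lam})
    (fun L => ?_) (ae_exists_forall_cubeAverage_lt μ hind ?_ hlam)
  · rw [Set.ofPred_forall]
    exact .iInter fun n => measurableSet_lt (measurable_cubeAverage (hind L) n) measurable_const
  · simpa only [lintegral_indicator_one (measurableSet_unmatchedNear _)] using
      tendsto_measure_unmatchedNear μ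

end Matching

/-- Here `s` is the radius of a cube that is small at scale `ρ`, and `n` that of a cube around the
origin which contains it, if the small one is centered at sup-distance at most `κ * ρ + 1`. -/
theorem exists_cube_radii {c κ ρ : ℝ} {q : ℕ} (hc : 1 ≤ c) (hκ : 0 ≤ κ) (hρ : 8 * c ≤ ρ)
    (hq : 4 * c * (2 * κ + 1) ≤ q) :
    ∃ s n : ℕ, c * (s + 1) ≤ ρ / 4 ∧ κ * ρ + 1 + s ≤ n ∧ 2 * n + 1 ≤ q * (2 * s + 1) := by
  have hρ0 : 0 < ρ := by linarith
  have two_le_floor : 2 ≤ ⌊ρ / (4 * c)⌋₊ := Nat.le_floor <| by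
    rw [le_div_iff₀ (by positivity)]
    push_cast
    linarith
  obtain ⟨s, hs⟩ : ∃ s, ⌊ρ / (4 * c)⌋₊ = s + 1 := Nat.exists_eq_succ_of_ne_zero (by lia)
  have one_le : (1 : ℝ) ≤ s := by exact_mod_cast (by lia : 1 ≤ s)
  have lower : (s + 1) * (4 * c) ≤ ρ := by
    rw [← le_div_iff₀ (by positivity)]
    exact_mod_cast hs ▸ Nat.floor_le (by positivity)
  have upper : ρ < (s + 2) * (4 * c) := by
    rw [← div_lt_iff₀ (by positivity)]
    have lt_floor_add_one := Nat.lt_floor_add_one (ρ / (4 * c))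
    rw [hs, Nat.cast_add_one] at lt_floor_add_one
    linarith
  refine ⟨s, ⌈κ * ρ + 1 + s⌉₊, by linarith, Nat.le_ceil _, ?_⟩
  have ceil_lt := Nat.ceil_lt_add_one (by positivity : 0 ≤ κ * ρ + 1 + s)
  suffices (2 * ⌈κ * ρ + 1 + s⌉₊ + 1 : ℝ) ≤ q * (2 * s + 1) by exact_mod_cast this
  calc (2 * ⌈κ * ρ + 1 + s⌉₊ + 1 : ℝ) ≤ (2 * κ + 1) * ρ := by nlinarith
    _ ≤ (2 * κ + 1) * (4 * c * (2 * s + 1)) := by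
      gcongr
      nlinarith
    _ = 4 * c * (2 * κ + 1) * (2 * s + 1) := by ring
    _ ≤ q * (2 * s + 1) := by gcongr

theorem exists_mem_latticeCube_vadd_notMem {d : ℕ} {α : Type*} [VAdd (Fin d → ℤ) α] {E : Set α}
    {x : α} {q n s : ℕ} {k : Fin d → ℤ}
    (havg : cubeAverage d (E.indicator 1) n x < ((q : ENNReal) ^ d)⁻¹)
    (hsn : 2 * n + 1 ≤ q * (2 * s + 1)) (hsub : latticeCube k s ⊆ latticeCube 0 n) :
    ∃ j ∈ latticeCube k s, j +ᵥ x ∉ E := by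
  by_contra! hE
  refine havg.not_ge (le_cubeAverage_iff.2 ?_)
  have volume_le : (2 * n + 1 : ENNReal) ^ d ≤ (2 * s + 1) ^ d * q ^ d := by
    rw [← mul_pow, mul_comm (2 * s + 1 : ENNReal)]
    exact_mod_cast Nat.pow_le_pow_left hsn d
  calc ((q : ENNReal) ^ d)⁻¹ * (2 * n + 1) ^ d ≤ (2 * s + 1) ^ d := by
        rw [mul_comm, ← div_eq_mul_inv]
        exact ENNReal.div_le_of_le_mul volume_le
    _ = ∑ j ∈ latticeCube k s, E.indicator (1 : α → ENNReal) (j +ᵥ x) := by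
        rw [Finset.sum_congr rfl fun j hj => Set.indicator_of_mem (hE j hj) 1]
        simp [card_latticeCube]
    _ ≤ ∑ j ∈ latticeCube 0 n, E.indicator (1 : α → ENNReal) (j +ᵥ x) :=
        Finset.sum_le_sum_of_subset hsub

namespace Matching

variable {d : ℕ}

theorem exists_norm_sub_le_norm_displacement_le {m : Matching d} (hne : m.X.carrier.Nonempty)
    {L q : ℕ}
    (havg : ∀ n, cubeAverage d ((unmatchedNear L).indicator 1) n m < ((q : ENNReal) ^ d)⁻¹)
    {κ ρ : ℝ} (hκ : 0 ≤ κ) (hρ : 8 * (d + 1) ≤ ρ) (hL : 4 * L ≤ ρ)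
    (hq : 4 * (d + 1) * (2 * κ + 1) ≤ q) {z : Space d} (hz : ∀ i, |z i| ≤ κ * ρ) :
    ∃ y : m.X.carrier, ‖(y : Space d) - z‖ ≤ ρ / 2 ∧ ‖(m.T y : Space d) - y‖ ≤ ρ / 2 := by
  obtain ⟨s, n, hs, hn, hsn⟩ := exists_cube_radii (by linarith [d.cast_nonneg (α := ℝ)]) hκ hρ hq
  let c : Fin d → ℤ := fun i => ⌊z i⌋
  have abs_floor_sub (i : Fin d) : |(c i : ℝ) - z i| ≤ 1 := by
    rw [abs_sub_comm, abs_le]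
    constructor <;> linarith [Int.floor_le (z i), Int.lt_floor_add_one (z i)]
  have dist_center : dist (-c) 0 ≤ κ * ρ + 1 := by
    rw [dist_zero_right, norm_neg, pi_norm_le_iff_of_nonneg (by nlinarith)]
    intro i
    rw [Int.norm_eq_abs]
    linarith [abs_sub_abs_le_abs_sub (c i : ℝ) (z i), abs_floor_sub i, hz i]
  obtain ⟨j, hj, hjE⟩ := exists_mem_latticeCube_vadd_notMem (havg n) hsn
    (latticeCube_subset_latticeCube (k := -c) (by linarith))
  obtain ⟨k, rfl⟩ : ∃ k, j = -k := ⟨-j, (neg_neg j).symm⟩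
  obtain ⟨y, hyk, hTyk⟩ := exists_norm_sub_latticePoint_le hne hjE
  have hkz : ‖latticePoint k - z‖ ≤ d * (s + 1) := by
    refine norm_le_mul_of_forall_abs_le (by positivity) fun i => ?_
    have hki : |(k i : ℝ) - c i| ≤ s := by
      exact_mod_cast mem_latticeCube.1 (neg_mem_latticeCube_neg.1 hj) i
    exact (abs_sub_le (k i : ℝ) (c i) (z i)).trans (add_le_add hki (abs_floor_sub i))
  refine ⟨y, ?_, ?_⟩
  · linarith [norm_sub_le_norm_sub_add_norm_sub (y : Space d) (latticePoint k) z]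
  · linarith [norm_sub_le_norm_sub_add_norm_sub (m.T y : Space d) (latticePoint k) y,
      norm_sub_rev (latticePoint k) (y : Space d)]

/-- Monotonicity of `T`, which is cyclical monotonicity restricted to cycles of two points. -/
def IsMonotone (m : Matching d) : Prop :=
  ∀ x y : m.X.carrier, 0 ≤ inner ℝ ((m.T x : Space d) - m.T y) ((x : Space d) - y)

theorem IsCyclicallyMonotone.isMonotone {m : Matching d} (hm : m.IsCyclicallyMonotone) :
    m.IsMonotone := by
  intro x y
  rcases eq_or_ne x y with rfl | hxy
  · simp
  have hinj : Function.Injective ![x, y] := by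
    simpa [Function.Injective, Fin.forall_fin_two, eq_comm] using hxy
  have hsum : 0 ≤ inner ℝ (m.T x : Space d) ((x : Space d) - y) +
      inner ℝ (m.T y : Space d) ((y : Space d) - x) :=
    (hm 1 ![x, y] hinj).trans_eq (Fin.sum_univ_two _)
  rwa [← neg_sub (x : Space d) y, inner_neg_right, ← sub_eq_add_neg, ← inner_sub_left] at hsum

theorem IsMonotone.norm_displacement_le {m : Matching d} (hm : m.IsMonotone) {L q : ℕ}
    (havg : ∀ n, cubeAverage d ((unmatchedNear L).indicator 1) n m < ((q : ENNReal) ^ d)⁻¹)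
    {κ ρ : ℝ} (hκ : 0 ≤ κ) (hρ : 8 * (d + 1) ≤ ρ) (hL : 4 * L ≤ ρ)
    (hq : 4 * (d + 1) * (2 * κ + 3) ≤ q) {x : m.X.carrier}
    (hx : ∀ i, |(x : Space d) i| ≤ κ * ρ) : ‖(m.T x : Space d) - x‖ ≤ 6 * ρ := by
  have hρ0 : 0 < ρ := by linarith [d.cast_nonneg (α := ℝ)]
  set D := (m.T x : Space d) - x
  have hstep : ‖(ρ / ‖D‖) • D‖ ≤ ρ := by
    rw [norm_smul, Real.norm_of_nonneg (by positivity), div_mul_eq_mul_div]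
    exact div_le_of_le_mul₀ (norm_nonneg D) hρ0.le le_rfl
  have hz (i : Fin d) : |((x : Space d) + (ρ / ‖D‖) • D) i| ≤ (κ + 1) * ρ := calc
    _ ≤ |(x : Space d) i| + |((ρ / ‖D‖) • D) i| := abs_add_le _ _
    _ ≤ κ * ρ + ρ := add_le_add (hx i) ((PiLp.norm_apply_le _ i).trans hstep)
    _ = (κ + 1) * ρ := by ring
  obtain ⟨y, hy, hTy⟩ := exists_norm_sub_le_norm_displacement_le ⟨x, x.2⟩ havg
    (by positivity : 0 ≤ κ + 1) hρ hL (hq.trans_eq' (by ring)) hz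
  exact norm_sub_le_of_inner_sub_nonneg hρ0 (hm x y) hy hTy

end Matching

theorem mainTheorem6_general {d : ℕ} {Ω : Type*} [MeasurableSpace Ω] (P : Measure Ω)
    [IsFiniteMeasure P] (M : Ω → Matching d) (hM : Measurable M)
    [VAddInvariantMeasure (Fin d → ℤ) (Matching d) (P.map M)]
    (hmono : ∀ᵐ ω ∂P, (M ω).IsMonotone) {ε : ℝ} (hε : 0 < ε) :
    ∃ r : Ω → ℝ, Measurable r ∧ (∀ ω, 0 < r ω) ∧
      ∀ᵐ ω ∂P, ∀ R : ℝ, r ω ≤ R → ∀ x : (M ω).X.carrier,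
        (∀ i, (x : Space d) i ∈ Set.Ioo (-R) R) →
          ‖((M ω).T x : Space d) - (x : Space d)‖ ≤ ε * R := by
  obtain ⟨q, hq⟩ := exists_nat_ge (4 * (d + 1) * (2 * (6 / ε) + 3))
  obtain ⟨L, hL, havg⟩ := Matching.exists_measurable_cubeAverage_unmatchedNear_lt (P.map M)
    (lam := ((q : ENNReal) ^ d)⁻¹) (ENNReal.inv_ne_zero.2 (by finiteness))
  refine ⟨fun ω => 6 / ε * (8 * (d + 1) + 4 * L (M ω)), ?_, fun ω => by positivity, ?_⟩
  · exact ((measurable_from_nat.comp (hL.comp hM)).const_mul 4).const_add _ |>.const_mul _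
  filter_upwards [hmono, ae_of_ae_map hM.aemeasurable havg] with ω hmonoω havgω R hR x hx
  have hscale : 8 * (d + 1) + 4 * (L (M ω) : ℝ) ≤ ε * R / 6 := by
    rw [div_mul_eq_mul_div, div_le_iff₀ hε] at hR
    linarith
  have hbox (i : Fin d) : |(x : Space d) i| ≤ 6 / ε * (ε * R / 6) := by
    rw [show 6 / ε * (ε * R / 6) = R by field_simp]
    exact (abs_lt.2 (hx i)).le
  have hL0 : 0 ≤ (L (M ω) : ℝ) := Nat.cast_nonneg _
  have hd0 : 0 ≤ (d : ℝ) := Nat.cast_nonneg d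
  calc _ ≤ 6 * (ε * R / 6) := hmonoω.norm_displacement_le havgω (by positivity)
        (by linarith [hL0]) (by linarith [hd0]) hq hbox
    _ = ε * R := by ring

theorem mainTheorem6 {d : ℕ} {Ω : Type*} [MeasurableSpace Ω] (P : Measure Ω)
    [IsProbabilityMeasure P] (M : Ω → Matching d) (hM : Measurable M)
    (hX : IsUnitPoissonProcess (fun ω => (M ω).X) P)
    (hY : IsUnitPoissonProcess (fun ω => (M ω).Y) P)
    (hXY : IndepFun (fun ω => (M ω).X) (fun ω => (M ω).Y) P)
    (herg : ErgodicVAdd (Fin d → ℤ) (Matching d) (P.map M))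
    (hmono : ∀ᵐ ω ∂P, (M ω).IsCyclicallyMonotone) :
    ∀ ε : ℝ, 0 < ε → ∃ r : Ω → ℝ, Measurable r ∧ (∀ ω, 0 < r ω) ∧
      ∀ᵐ ω ∂P, ∀ R : ℝ, r ω ≤ R → ∀ x : (M ω).X.carrier,
        (∀ i, (x : Space d) i ∈ Set.Ioo (-R) R) →
          ‖((M ω).T x : Space d) - (x : Space d)‖ ≤ ε * R := fun _ hε =>
  have := herg.toVAddInvariantMeasure
  mainTheorem6_general P M hM (hmono.mono fun _ h => h.isMonotone) hε
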